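/- Let $H$ be a real finite-dimensional Hilbert space, let $P:H\to H$ be an orthogonal projection, and let $\Lambda:H\to\mathbb{R}^m$ be a linear map with $\Lambda\Lambda^*=\mathrm{Id}_{m}$ and $\ker(P)\cap\ker(\Lambda)=\{0\}$; exclude the degenerate case where simultaneously $\dim H=1$, $P=\mathrm{Id}_H$ and $m=1$. Let $\varepsilon,\eta>0$, put $$\mathcal{K}=\{f\in H:\|Pf\|\le\varepsilon\},\qquad \mathcal{E}=\{e\in\mathbb{R}^m:\|e\|_2\le\eta\},$$ and let $y\in\mathbb{R}^m$ be such that $\mathcal{K}_{y,\mathcal{E}}=\{f\in H: f\in\mathcal{K}\text{ and }y-\Lambda f\in\mathcal{E}\}$ is nonempty. The Chebyshev radius of a set $S \subseteq H$ is the infimum of the radii of the closed balls containing $S$, and a Chebyshev center of $S$ is the center of a closed ball of that radius containing $S$. Then the set $\mathcal{K}_{y,\mathcal{E}}$ has a finite Chebyshev radius, and the square of this radius is equal to the optimal value of the semidefinite program $$\underset{c,d\ge 0,\;t\in\mathbb{R}}{\text{minimize}}\quad c\varepsilon^2+d\eta^2-d\|y\|_2^2+t\quad\text{subject to}\quad cP+d\Lambda^*\Lambda\succeq\mathrm{Id}_H\quad\text{and}\quad\begin{bmatrix}cP+d\Lambda^*\Lambda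 & d\Lambda^*y\\ d\,y^*\Lambda & t\end{bmatrix}\succeq 0,$$ which is attained. Moreover, for every solution $(\widetilde c,\widetilde d,\widetilde t)$ of this program, the function $f\mapsto\widetilde c\,\|Pf\|^2+\widetilde d\,\|y-\Lambda f\|_2^2$ has a unique minimizer $f_{\widetilde c,\widetilde d}$ over $H$, and $f_{\widetilde c,\widetilde d}$ is the unique Chebyshev center of $\mathcal{K}_{y,\mathcal{E}}$. -/

import Mathlib

namespace ChebyshevSDP

noncomputable section

/-- The radii of the closed balls that contain `S`. -/
def coveringRadii {H : Type*} [NormedAddCommGroup H] (S : Set H) : Set ℝ :=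
  {r | 0 ≤ r ∧ ∃ z : H, S ⊆ Metric.closedBall z r}

/-- `r` is the Chebyshev radius of `S`: the infimum of the radii of the balls containing `S`,
that is, `inf_z sup_{f ∈ S} ‖f - z‖`. Stating it as a greatest lower bound includes that some ball
contains `S`. -/
def IsChebyshevRadius {H : Type*} [NormedAddCommGroup H] (S : Set H) (r : ℝ) : Prop :=
  IsGLB (coveringRadii S) r

/-- `z` is a Chebyshev center of `S`: the center of a smallest-radius ball containing `S`. -/
def IsChebyshevCenter {H : Type*} [NormedAddCommGroup H] (S : Set H) (z : H) : Prop :=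
  ∃ r : ℝ, IsChebyshevRadius S r ∧ S ⊆ Metric.closedBall z r

variable {H : Type*} [NormedAddCommGroup H] [InnerProductSpace ℝ H]

/-- The model set `{f : ‖P f‖ ≤ ε}`. -/
def modelSet (P : H →ₗ[ℝ] H) (ε : ℝ) : Set H := {f | ‖P f‖ ≤ ε}

/-- The uncertainty set `{e : ‖e‖₂ ≤ η}`. -/
def uncertaintySet (m : ℕ) (η : ℝ) : Set (EuclideanSpace ℝ (Fin m)) := {e | ‖e‖ ≤ η}

/-- The elements of `K` that are consistent with the data `y` up to an error in `E`. -/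
def consistentSet {m : ℕ} (Λ : H →ₗ[ℝ] EuclideanSpace ℝ (Fin m)) (K : Set H)
    (E : Set (EuclideanSpace ℝ (Fin m))) (y : EuclideanSpace ℝ (Fin m)) : Set H :=
  {f | f ∈ K ∧ y - Λ f ∈ E}

/-- The operator `[T, v; φ, t]` on the Hilbert sum of `H` and `ℝ`, which maps `(h, s)` to
`(T h + s v, φ h + t s)`. -/
def blockOperator (T : H →ₗ[ℝ] H) (v : H) (φ : H →ₗ[ℝ] ℝ) (t : ℝ) :
    WithLp 2 (H × ℝ) →ₗ[ℝ] WithLp 2 (H × ℝ) where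
  toFun x := WithLp.toLp 2 (T x.fst + x.snd • v, φ x.fst + t * x.snd)
  map_add' x y := by
    apply (WithLp.equiv 2 (H × ℝ)).injective
    refine Prod.ext ?_ ?_
    · simp [add_smul]; abel
    · simp; ring
  map_smul' a x := by
    apply (WithLp.equiv 2 (H × ℝ)).injective
    refine Prod.ext ?_ ?_
    · simp [mul_smul]
    · simp; ring

variable [FiniteDimensional ℝ H] {m : ℕ}

/-- The operator `c P + d Λ* Λ`. -/
def combination (P : H →ₗ[ℝ] H) (Λ : H →ₗ[ℝ] EuclideanSpace ℝ (Fin m)) (c d : ℝ) : H →ₗ[ℝ] H :=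
  c • P + d • (Λ.adjoint ∘ₗ Λ)

/-- The feasible triples `(c, d, t)` of the semidefinite program. -/
def sdpFeasible (P : H →ₗ[ℝ] H) (Λ : H →ₗ[ℝ] EuclideanSpace ℝ (Fin m))
    (y : EuclideanSpace ℝ (Fin m)) : Set (ℝ × ℝ × ℝ) :=
  {(c, d, t) | 0 ≤ c ∧ 0 ≤ d ∧
    (combination P Λ c d - LinearMap.id).IsPositive ∧
    (blockOperator (combination P Λ c d) (d • Λ.adjoint y)
      (d • (innerₗ (EuclideanSpace ℝ (Fin m)) y ∘ₗ Λ)) t).IsPositive}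

/-- The objective function of the semidefinite program. -/
def sdpObjective (ε η : ℝ) (y : EuclideanSpace ℝ (Fin m)) : ℝ × ℝ × ℝ → ℝ :=
  fun (c, d, t) => c * ε ^ 2 + d * η ^ 2 - d * ‖y‖ ^ 2 + t

/-- `(c, d, t)` solves the semidefinite program: it is feasible and minimizes the objective. -/
def IsSDPSolution (P : H →ₗ[ℝ] H) (Λ : H →ₗ[ℝ] EuclideanSpace ℝ (Fin m)) (ε η : ℝ)
    (y : EuclideanSpace ℝ (Fin m)) (x : ℝ × ℝ × ℝ) : Prop :=
  x ∈ sdpFeasible P Λ y ∧ IsMinOn (sdpObjective ε η y) (sdpFeasible P Λ y) x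

/-- The set of minimizers over `H` of `c ‖P f‖² + d ‖y - Λ f‖²`. -/
def regularizers (P : H →ₗ[ℝ] H) (Λ : H →ₗ[ℝ] EuclideanSpace ℝ (Fin m))
    (y : EuclideanSpace ℝ (Fin m)) (c d : ℝ) : Set H :=
  {f | IsMinOn (fun g : H => c * ‖P g‖ ^ 2 + d * ‖y - Λ g‖ ^ 2) Set.univ f}

end

end ChebyshevSDP

open ChebyshevSDP

/-
Weak duality. If `(c, d, t)` is feasible, completing the square in `c ‖P x‖² + d ‖y - Λ x‖²` around
its minimizer `f` shows that every point `x` of the consistent set satisfies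
`‖x - f‖² ≤ c ε² + d η² - d ‖y‖² + t`.

Strong duality. It remains to find a feasible triple and a segment `[f - v, f + v]` in the
consistent set with `‖v‖²` equal to the objective: by the parallelogram law a ball containing both
endpoints has radius at least `‖v‖`, with equality only if it is centered at `f`. Write
`y = Λ (u + q)` with `P u = 0` and `q` in the ranges of both `P` and `Λ* Λ`. The regularizer for
weights proportional to `(1 - τ, τ)` is `u + τ q`, and the objective to minimize is `g(τ) / l(τ)`,
where `g(τ) = (1 - τ) ε² + τ η² - τ (1 - τ) ‖q‖²` and `l(τ)` is the smallest eigenvalue of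
`(1 - τ) P + τ Λ* Λ` on the orthogonal complement of `q`. At an interior minimizer `τ` the
first-order conditions from the two sides give two eigenvectors, on which the derivative of the
pencil lies on either side of the value dictated by `g'(τ)`. By continuity some eigenvector `v`
attains it exactly, and for that `v` both constraints hold at `u + τ q ± v`. At an endpoint the
one-sided condition is enough.
-/

namespace ChebyshevSDP

open Filter Topology InnerProductSpace
open scoped RealInnerProductSpace

section Compactness

theorem exists_pos_forall_div_mul_le {X : Type*} [TopologicalSpace X] {K : Set X} (hK : IsCompact K)
    {g l : X → ℝ} (hg : ContinuousOn g K) (hl : ContinuousOn l K) (hg0 : ∀ x ∈ K, 0 ≤ g x)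
    (hl0 : ∀ x ∈ K, 0 ≤ l x) (hgl : ∀ x ∈ K, l x = 0 → 0 < g x) (hpos : ∃ x ∈ K, 0 < l x) :
    ∃ x ∈ K, 0 < l x ∧ ∀ z ∈ K, g x / l x * l z ≤ g z := by
  obtain ⟨w, hw, hlw⟩ := hpos
  have hsum : ∀ x ∈ K, 0 < g x + l x := fun x hx => by
    rcases (hl0 x hx).eq_or_lt with h | h
    · rw [← h, add_zero]
      exact hgl x hx h.symm
    · exact add_pos_of_nonneg_of_pos (hg0 x hx) h
  -- Minimizing `g / l` amounts to maximizing `l / (g + l)`, which has no poles.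
  obtain ⟨x, hx, hmax⟩ := hK.exists_isMaxOn ⟨w, hw⟩ (f := fun x => l x / (g x + l x))
    (hl.div (hg.add hl) fun x hx => (hsum x hx).ne')
  have hlx : 0 < l x :=
    (div_pos_iff_of_pos_right (hsum x hx)).1 ((div_pos hlw (hsum w hw)).trans_le (hmax hw))
  refine ⟨x, hx, hlx, fun z hz => ?_⟩
  have hxz : l z * (g x + l x) ≤ l x * (g z + l z) :=
    (div_le_div_iff₀ (hsum z hz) (hsum x hx)).1 (hmax hz)
  rw [div_mul_eq_mul_div, div_le_iff₀ hlx]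
  linarith

theorem exists_eq_zero_and_nonpos_of_frequently {X : Type*} [TopologicalSpace X]
    [FirstCountableTopology X] {S : Set X} (hS : IsCompact S) {F D : X → ℝ} (hF : Continuous F)
    (hD : Continuous D) (hF0 : ∀ x ∈ S, 0 ≤ F x) {ρ : ℝ → ℝ} (hρ : Tendsto ρ (𝓝[>] 0) (𝓝 0))
    (h : ∃ᶠ t in 𝓝[>] 0, ∃ x ∈ S, F x + t * (D x + ρ t) ≤ 0) :
    ∃ x ∈ S, F x = 0 ∧ D x ≤ 0 := by
  obtain ⟨t, ht, hx⟩ := exists_seq_forall_of_frequently (h.and_eventually self_mem_nhdsWithin)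
  choose x hxS hle using fun n => (hx n).1
  obtain ⟨a, haS, φ, hφ, ha⟩ := hS.tendsto_subseq hxS
  have htφ : Tendsto (t ∘ φ) atTop (𝓝[>] 0) := ht.comp hφ.tendsto_atTop
  have ht0 : Tendsto (t ∘ φ) atTop (𝓝 0) := htφ.mono_right nhdsWithin_le_nhds
  have hFa : Tendsto (fun n => F (x (φ n))) atTop (𝓝 (F a)) := (hF.tendsto a).comp ha
  have hDa : Tendsto (fun n => D (x (φ n)) + ρ (t (φ n))) atTop (𝓝 (D a)) := by
    simpa using ((hD.tendsto a).comp ha).add (hρ.comp htφ)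
  refine ⟨a, haS, le_antisymm ?_ (hF0 a haS), le_of_tendsto' hDa fun n => ?_⟩
  · simpa using le_of_tendsto' (hFa.add (ht0.mul hDa)) fun n => hle (φ n)
  · have hpos : 0 < t (φ n) := (hx (φ n)).2
    have hneg : t (φ n) * (D (x (φ n)) + ρ (t (φ n))) ≤ 0 := by
      linarith [hle (φ n), hF0 _ (hxS (φ n))]
    exact nonpos_of_mul_nonpos_right hneg hpos

end Compactness

section QuadraticForms

open QuadraticMap (polar)

theorem polar_eq_zero_of_nonneg {V : Type*} [AddCommGroup V] [Module ℝ V] {F : QuadraticForm ℝ V}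
    (hF : ∀ x, 0 ≤ F x) {x y : V} (hx : F x = 0) (hy : F y = 0) : polar F x y = 0 := by
  have hadd := hF (x + y)
  have hsub := hF (x + -y)
  rw [QuadraticMap.map_add F, hx, hy] at hadd
  rw [QuadraticMap.map_add F, F.map_neg, QuadraticMap.polar_neg_right, hx, hy] at hsub
  linarith

theorem quadraticForm_smul_add_smul {V : Type*} [AddCommGroup V] [Module ℝ V]
    (D : QuadraticForm ℝ V) (a b : ℝ) (x y : V) :
    D (a • x + b • y) = a ^ 2 * D x + b ^ 2 * D y + a * b * polar D x y := by
  rw [QuadraticMap.map_add D, D.map_smul, D.map_smul, QuadraticMap.polar_smul_left,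
    QuadraticMap.polar_smul_right]
  simp only [smul_eq_mul]
  ring

theorem exists_isotropic_of_signs {V : Type*} [AddCommGroup V] [Module ℝ V]
    {F D : QuadraticForm ℝ V} (hF : ∀ x, 0 ≤ F x) {x y : V} (hx0 : x ≠ 0) (hy0 : y ≠ 0)
    (hx : F x = 0) (hy : F y = 0) (hDx : 0 ≤ D x) (hDy : D y ≤ 0) :
    ∃ z ≠ 0, F z = 0 ∧ D z = 0 := by
  by_contra! hne
  replace hDx : 0 < D x := hDx.lt_of_ne' (hne x hx0 hx)
  replace hDy : D y < 0 := hDy.lt_of_ne (hne y hy0 hy)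
  have hcont : ContinuousOn (fun s : ℝ => D ((1 - s) • x + s • y)) (Set.Icc 0 1) := by
    simp only [quadraticForm_smul_add_smul]
    fun_prop
  obtain ⟨s, -, hs⟩ := intermediate_value_Icc' zero_le_one hcont
    (show (0 : ℝ) ∈ _ from ⟨by simpa using hDy.le, by simpa using hDx.le⟩)
  have hFz : F ((1 - s) • x + s • y) = 0 := by
    rw [quadraticForm_smul_add_smul, hx, hy, polar_eq_zero_of_nonneg hF hx hy]
    ring
  refine hne _ (fun hz => ?_) hFz hs
  have hD : (1 - s) ^ 2 * D x = s ^ 2 * D y := by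
    have := congrArg D (eq_neg_of_add_eq_zero_left hz)
    simpa [D.map_smul, sq] using this
  have hs0 : s ^ 2 * D y = 0 :=
    le_antisymm (mul_nonpos_of_nonneg_of_nonpos (sq_nonneg s) hDy.le)
      (hD ▸ mul_nonneg (sq_nonneg _) hDx.le)
  have hs1 := hD.trans hs0
  simp [hDx.ne', hDy.ne, sub_eq_zero] at hs0 hs1
  linarith

theorem continuous_quadraticForm {V : Type*} [NormedAddCommGroup V] [NormedSpace ℝ V]
    [FiniteDimensional ℝ V] (Q : QuadraticForm ℝ V) : Continuous Q := by
  have hcont : Continuous fun x => (QuadraticMap.associated Q).toContinuousBilinearMap x x := by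
    fun_prop
  exact hcont.congr (QuadraticMap.associated_eq_self_apply ℝ Q)

/-- The minimum of a quadratic form over the unit sphere. On an inner product space this is the
smallest eigenvalue of the symmetric operator that represents the form. -/
noncomputable def sphereMin {V : Type*} [NormedAddCommGroup V] [NormedSpace ℝ V]
    (Q : QuadraticForm ℝ V) : ℝ :=
  sInf (Q '' Metric.sphere 0 1)

variable {V : Type*} [NormedAddCommGroup V] [NormedSpace ℝ V] [FiniteDimensional ℝ V]

theorem exists_norm_eq_one_eq_sphereMin [Nontrivial V] (Q : QuadraticForm ℝ V) :
    ∃ x, ‖x‖ = 1 ∧ Q x = sphereMin Q := by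
  obtain ⟨x, hx, hQ⟩ := ((isCompact_sphere (0 : V) 1).image (continuous_quadraticForm Q)).sInf_mem
    ((NormedSpace.sphere_nonempty.2 zero_le_one).image Q)
  exact ⟨x, by simpa using hx, hQ⟩

theorem sphereMin_mul_norm_sq_le (Q : QuadraticForm ℝ V) (x : V) :
    sphereMin Q * ‖x‖ ^ 2 ≤ Q x := by
  rcases eq_or_ne x 0 with rfl | hx
  · simp
  have hn : ‖x‖ ≠ 0 := norm_ne_zero_iff.2 hx
  have hbdd : BddBelow (Q '' Metric.sphere 0 1) :=
    ((isCompact_sphere 0 1).image (continuous_quadraticForm Q)).bddBelow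
  have hle : sphereMin Q ≤ Q (‖x‖⁻¹ • x) :=
    csInf_le hbdd ⟨_, by simp [norm_smul, hn], rfl⟩
  rwa [Q.map_smul, smul_eq_mul, ← mul_inv, inv_mul_eq_div, ← sq, le_div_iff₀ (by positivity)] at hle

theorem sphereMin_nonneg [Nontrivial V] {Q : QuadraticForm ℝ V} (hQ : ∀ x, 0 ≤ Q x) :
    0 ≤ sphereMin Q := by
  obtain ⟨x, -, hx⟩ := exists_norm_eq_one_eq_sphereMin Q
  exact hx ▸ hQ x

theorem sphereMin_pos [Nontrivial V] {Q : QuadraticForm ℝ V} (hQ : Q.PosDef) :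
    0 < sphereMin Q := by
  obtain ⟨x, hx1, hx⟩ := exists_norm_eq_one_eq_sphereMin Q
  exact hx ▸ hQ x (norm_ne_zero_iff.1 (hx1 ▸ one_ne_zero))

/-- The pencil of quadratic forms that joins `A` (at `s = 0`) to `B` (at `s = 1`). Up to scaling, it
contains every combination of `A` and `B` with nonnegative multipliers. -/
def pencil {V : Type*} [AddCommGroup V] [Module ℝ V] (A B : QuadraticForm ℝ V) (s : ℝ) :
    QuadraticForm ℝ V :=
  (1 - s) • A + s • B

theorem pencil_apply {V : Type*} [AddCommGroup V] [Module ℝ V] (A B : QuadraticForm ℝ V) (s : ℝ)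
    (x : V) : pencil A B s x = (1 - s) * A x + s * B x := rfl

theorem pencil_nonneg {V : Type*} [AddCommGroup V] [Module ℝ V] {A B : QuadraticForm ℝ V}
    (hA : ∀ x, 0 ≤ A x) (hB : ∀ x, 0 ≤ B x) {s : ℝ} (hs : s ∈ Set.Icc (0 : ℝ) 1) (x : V) :
    0 ≤ pencil A B s x :=
  add_nonneg (mul_nonneg (sub_nonneg.2 hs.2) (hA x)) (mul_nonneg hs.1 (hB x))

theorem posDef_pencil {V : Type*} [AddCommGroup V] [Module ℝ V] {A B : QuadraticForm ℝ V}
    (hA : ∀ x, 0 ≤ A x) (hB : ∀ x, 0 ≤ B x) (hAB : ∀ x, A x = 0 → B x = 0 → x = 0) {s : ℝ}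
    (hs : s ∈ Set.Ioo (0 : ℝ) 1) : (pencil A B s).PosDef := by
  refine QuadraticMap.posDef_of_nonneg (pencil_nonneg hA hB (Set.Ioo_subset_Icc_self hs))
    fun x hx => ?_
  have h1 : 0 < 1 - s := sub_pos.2 hs.2
  have := (add_eq_zero_iff_of_nonneg (mul_nonneg h1.le (hA x)) (mul_nonneg hs.1.le (hB x))).1 hx
  exact hAB x ((mul_eq_zero_iff_left h1.ne').1 this.1) ((mul_eq_zero_iff_left hs.1.ne').1 this.2)

theorem continuous_sphereMin_pencil (A B : QuadraticForm ℝ V) :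
    Continuous fun s => sphereMin (pencil A B s) := by
  have hA := continuous_quadraticForm A
  have hB := continuous_quadraticForm B
  refine (isCompact_sphere (0 : V) 1).continuous_sInf (f := fun s x => pencil A B s x) ?_
  simp only [Function.HasUncurry.uncurry, id, pencil_apply]
  fun_prop

end QuadraticForms

section Pencil

/-- The quadratic form `x ↦ ‖T x‖²`. The two constraints enter the pencil as `normSqForm P` and
`normSqForm Λ`, restricted to a subspace. -/
noncomputable def normSqForm {V E : Type*} [AddCommGroup V] [Module ℝ V] [NormedAddCommGroup E]
    [InnerProductSpace ℝ E] (T : V →ₗ[ℝ] E) : QuadraticForm ℝ V :=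
  (LinearMap.BilinMap.toQuadraticMap (innerₗ E)).comp T

theorem normSqForm_apply {V E : Type*} [AddCommGroup V] [Module ℝ V] [NormedAddCommGroup E]
    [InnerProductSpace ℝ E] (T : V →ₗ[ℝ] E) (x : V) : normSqForm T x = ‖T x‖ ^ 2 :=
  real_inner_self_eq_norm_sq (T x)

theorem exists_norm_eq_one_eq_and_eq {V : Type*} [NormedAddCommGroup V] [InnerProductSpace ℝ V]
    {Q D : QuadraticForm ℝ V} {μ ν : ℝ} (hQ : ∀ z, μ * ‖z‖ ^ 2 ≤ Q z) {x y : V} (hx1 : ‖x‖ = 1)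
    (hy1 : ‖y‖ = 1) (hx : Q x = μ) (hy : Q y = μ) (hDx : D x ≤ ν) (hDy : ν ≤ D y) :
    ∃ z, ‖z‖ = 1 ∧ Q z = μ ∧ D z = ν := by
  have happly : ∀ (C : QuadraticForm ℝ V) (a : ℝ) z,
      (C - a • normSqForm LinearMap.id : QuadraticForm ℝ V) z = C z - a * ‖z‖ ^ 2 :=
    fun C a z => congrArg (fun b => C z - a * b) (normSqForm_apply LinearMap.id z)
  have hunit : ∀ (C : QuadraticForm ℝ V) (a : ℝ) z, ‖z‖ = 1 →
      (C - a • normSqForm LinearMap.id : QuadraticForm ℝ V) z = C z - a := fun C a z hz => by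
    rw [happly, hz, one_pow, mul_one]
  obtain ⟨z, hz0, hQz, hDz⟩ := exists_isotropic_of_signs
    (F := Q - μ • normSqForm LinearMap.id) (D := D - ν • normSqForm LinearMap.id)
    (fun z => (happly Q μ z).symm ▸ sub_nonneg.2 (hQ z))
    (norm_ne_zero_iff.1 (hy1 ▸ one_ne_zero)) (norm_ne_zero_iff.1 (hx1 ▸ one_ne_zero))
    (by rw [hunit Q μ y hy1, hy, sub_self]) (by rw [hunit Q μ x hx1, hx, sub_self])
    ((hunit D ν y hy1).symm ▸ sub_nonneg.2 hDy) ((hunit D ν x hx1).symm ▸ sub_nonpos.2 hDx)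
  have hnorm : ‖‖z‖⁻¹ • z‖ = 1 := norm_smul_inv_norm hz0
  refine ⟨_, hnorm, sub_eq_zero.1 ?_, sub_eq_zero.1 ?_⟩
  · rw [← hunit Q μ _ hnorm, QuadraticMap.map_smul, hQz, smul_zero]
  · rw [← hunit D ν _ hnorm, QuadraticMap.map_smul, hDz, smul_zero]

variable {V : Type*} [NormedAddCommGroup V] [InnerProductSpace ℝ V] [FiniteDimensional ℝ V]
  [Nontrivial V] {A B : QuadraticForm ℝ V} {g : ℝ → ℝ} {g' R τ : ℝ}

theorem exists_eq_and_sub_mul_le (hg : HasDerivAt g g' τ) (hR : 0 ≤ R)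
    (hτ : τ ∈ Set.Icc (0 : ℝ) 1) (hRτ : R * sphereMin (pencil A B τ) = g τ)
    (hRg : ∀ s ∈ Set.Icc (0 : ℝ) 1, R * sphereMin (pencil A B s) ≤ g s) {s : ℝ}
    (hs : s ∈ Set.Icc (0 : ℝ) 1) :
    ∃ x : V, ‖x‖ = 1 ∧ R * pencil A B τ x = g τ ∧
      (s - τ) * (R * (B x - A x)) ≤ (s - τ) * g' := by
  have hA := continuous_quadraticForm A
  have hB := continuous_quadraticForm B
  have hγ : HasDerivAt (fun t => g (τ + t * (s - τ))) ((s - τ) * g') 0 := by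
    have hline : HasDerivAt (fun t => τ + t * (s - τ)) (s - τ) 0 := by
      simpa using ((hasDerivAt_id (0 : ℝ)).mul_const (s - τ)).const_add τ
    rw [mul_comm]
    exact HasDerivAt.comp (h₂ := g) 0 (by simpa using hg) hline
  have hρ : Tendsto (fun t => (s - τ) * g' - t⁻¹ * (g (τ + t * (s - τ)) - g τ))
      (𝓝[>] 0) (𝓝 0) := by
    have hslope := hγ.tendsto_slope_zero_right.const_sub ((s - τ) * g')
    simpa using hslope
  obtain ⟨x, hx, hFx, hDx⟩ := exists_eq_zero_and_nonpos_of_frequently (isCompact_sphere (0 : V) 1)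
    (F := fun x => R * pencil A B τ x - g τ)
    (D := fun x => (s - τ) * (R * (B x - A x) - g'))
    (by simp only [pencil_apply]; fun_prop) (by fun_prop)
    (fun x hx => by
      have hle := mul_le_mul_of_nonneg_left (sphereMin_mul_norm_sq_le (pencil A B τ) x) hR
      rw [mem_sphere_zero_iff_norm.1 hx, one_pow, mul_one, hRτ] at hle
      exact sub_nonneg.2 hle) hρ
    (Eventually.frequently <| by
      filter_upwards [Ioc_mem_nhdsGT (zero_lt_one' ℝ)] with t ht
      obtain ⟨x, hx, hmin⟩ := exists_norm_eq_one_eq_sphereMin (pencil A B (τ + t * (s - τ)))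
      have hmem : τ + t * (s - τ) ∈ Set.Icc (0 : ℝ) 1 :=
        (convex_Icc 0 1).add_smul_sub_mem hτ hs ⟨ht.1.le, ht.2⟩
      refine ⟨x, mem_sphere_zero_iff_norm.2 hx, ?_⟩
      have hle := hRg _ hmem
      rw [← hmin] at hle
      simp only [pencil_apply] at hle ⊢
      have := mul_inv_cancel_left₀ ht.1.ne' (g (τ + t * (s - τ)) - g τ)
      linarith)
  refine ⟨x, mem_sphere_zero_iff_norm.1 hx, sub_eq_zero.1 hFx, ?_⟩
  rw [mul_sub] at hDx
  exact sub_nonpos.1 hDx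

theorem exists_mul_le_and_mul_le (hg : HasDerivAt g g' τ) (hR : 0 ≤ R)
    (hτ : τ ∈ Set.Icc (0 : ℝ) 1) (hRτ : R * sphereMin (pencil A B τ) = g τ)
    (hRg : ∀ s ∈ Set.Icc (0 : ℝ) 1, R * sphereMin (pencil A B s) ≤ g s) :
    ∃ z : V, ‖z‖ = 1 ∧ R * A z ≤ g τ - τ * g' ∧ R * B z ≤ g τ + (1 - τ) * g' := by
  obtain ⟨x, hx1, hx, hDx⟩ := exists_eq_and_sub_mul_le hg hR hτ hRτ hRg
    (Set.right_mem_Icc.2 zero_le_one)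
  obtain ⟨y, hy1, hy, hDy⟩ := exists_eq_and_sub_mul_le hg hR hτ hRτ hRg
    (Set.left_mem_Icc.2 zero_le_one)
  rcases hτ.1.eq_or_lt with rfl | hτ0
  · rw [pencil_apply] at hx
    exact ⟨x, hx1, by linarith, by linarith⟩
  rcases hτ.2.eq_or_lt with rfl | hτ1
  · rw [pencil_apply] at hy
    exact ⟨y, hy1, by linarith, by linarith⟩
  rw [zero_sub, neg_mul, neg_mul, neg_le_neg_iff] at hDy
  obtain ⟨z, hz1, hz, hDz⟩ := exists_norm_eq_one_eq_and_eq (Q := R • pencil A B τ)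
    (D := R • (B - A)) (μ := g τ) (ν := g')
    (fun z => by
      rw [← hRτ, mul_assoc]
      exact mul_le_mul_of_nonneg_left (sphereMin_mul_norm_sq_le _ z) hR)
    hx1 hy1 hx hy (le_of_mul_le_mul_left hDx (sub_pos.2 hτ1))
    (le_of_mul_le_mul_left hDy hτ0)
  change R * ((1 - τ) * A z + τ * B z) = g τ at hz
  change R * (B z - A z) = g' at hDz
  exact ⟨z, hz1, by linear_combination hz - τ * hDz, by linear_combination hz + (1 - τ) * hDz⟩

theorem exists_norm_sq_le_pencil_and_le {g' : ℝ → ℝ} (hA : ∀ x, 0 ≤ A x)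
    (hB : ∀ x, 0 ≤ B x) (hAB : ∀ x, A x = 0 → B x = 0 → x = 0)
    (hg : ∀ s ∈ Set.Icc (0 : ℝ) 1, HasDerivAt g (g' s) s) (hg0 : ∀ s ∈ Set.Icc (0 : ℝ) 1, 0 ≤ g s)
    (h0 : 0 < g 0) (h1 : 0 < g 1) :
    ∃ τ ∈ Set.Icc (0 : ℝ) 1, ∃ l > 0, (∀ x, l * ‖x‖ ^ 2 ≤ pencil A B τ x) ∧
      ∃ v : V, l * ‖v‖ ^ 2 = g τ ∧ A v ≤ g τ - τ * g' τ ∧ B v ≤ g τ + (1 - τ) * g' τ := by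
  have hpos : ∀ s ∈ Set.Ioo (0 : ℝ) 1, 0 < sphereMin (pencil A B s) := fun s hs =>
    sphereMin_pos (posDef_pencil hA hB hAB hs)
  have hends : ∀ s ∈ Set.Icc (0 : ℝ) 1, sphereMin (pencil A B s) = 0 → 0 < g s := by
    intro s hs hls
    rcases Set.eq_endpoints_or_mem_Ioo_of_mem_Icc hs with rfl | rfl | hs
    · exact h0
    · exact h1
    · exact absurd hls (hpos s hs).ne'
  obtain ⟨τ, hτ, hl, hmin⟩ := exists_pos_forall_div_mul_le isCompact_Icc
    (fun s hs => (hg s hs).continuousAt.continuousWithinAt)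
    (continuous_sphereMin_pencil A B).continuousOn hg0
    (fun s hs => sphereMin_nonneg (pencil_nonneg hA hB hs)) hends
    ⟨2⁻¹, by norm_num, hpos _ (by norm_num)⟩
  have hR : 0 ≤ g τ / sphereMin (pencil A B τ) := div_nonneg (hg0 τ hτ) hl.le
  obtain ⟨z, hz1, hAz, hBz⟩ := exists_mul_le_and_mul_le (hg τ hτ) hR hτ
    (div_mul_cancel₀ _ hl.ne') hmin
  refine ⟨τ, hτ, _, hl, sphereMin_mul_norm_sq_le _, √(g τ / sphereMin (pencil A B τ)) • z,
    ?_, ?_, ?_⟩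
  · rw [norm_smul, mul_pow, hz1, Real.norm_of_nonneg (Real.sqrt_nonneg _), Real.sq_sqrt hR,
      one_pow, mul_one, mul_div_cancel₀ _ hl.ne']
  · rwa [A.map_smul, Real.mul_self_sqrt hR]
  · rwa [B.map_smul, Real.mul_self_sqrt hR]

end Pencil

section Projections

variable {E F : Type*} [NormedAddCommGroup E] [InnerProductSpace ℝ E] [NormedAddCommGroup F]
  [InnerProductSpace ℝ F]

theorem inner_map_self_of_isSymmetricProjection {P : E →ₗ[ℝ] E} (hP : P.IsSymmetricProjection)
    (x : E) : ⟪P x, x⟫ = ‖P x‖ ^ 2 := by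
  have hPP : P (P x) = P x := LinearMap.congr_fun hP.isIdempotentElem.eq x
  rw [← real_inner_self_eq_norm_sq, ← hP.isSymmetric (P x) x, hPP]

theorem norm_map_le_of_isSymmetricProjection {P : E →ₗ[ℝ] E} (hP : P.IsSymmetricProjection)
    (x : E) : ‖P x‖ ≤ ‖x‖ := by
  obtain ⟨K, hK, rfl⟩ := LinearMap.isSymmetricProjection_iff_eq_coe_starProjection.1 hP
  exact K.norm_starProjection_apply_le x

theorem norm_map_smul_add_sq (T : E →ₗ[ℝ] F) {q w : E} (hT : ∀ x, ⟪T q, T x⟫ = ⟪q, x⟫)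
    (hqw : ⟪q, w⟫ = 0) (a : ℝ) : ‖T (a • q + w)‖ ^ 2 = a ^ 2 * ‖q‖ ^ 2 + ‖T w‖ ^ 2 := by
  have hTq : ‖T q‖ ^ 2 = ‖q‖ ^ 2 := by
    rw [← real_inner_self_eq_norm_sq, hT, real_inner_self_eq_norm_sq]
  rw [map_add, map_smul, norm_add_sq_real, real_inner_smul_left, hT, hqw, norm_smul, mul_pow,
    Real.norm_eq_abs, sq_abs, hTq]
  ring

variable [FiniteDimensional ℝ E] [FiniteDimensional ℝ F] {Λ : E →ₗ[ℝ] F}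

theorem isSymmetricProjection_adjoint_comp_self (hΛ : Λ ∘ₗ Λ.adjoint = LinearMap.id) :
    (Λ.adjoint ∘ₗ Λ).IsSymmetricProjection where
  isIdempotentElem := LinearMap.ext fun x =>
    congrArg Λ.adjoint (LinearMap.congr_fun hΛ (Λ x))
  isSymmetric := LinearMap.isSymmetric_adjoint_comp_self Λ

theorem norm_map_le_of_comp_adjoint_eq_id (hΛ : Λ ∘ₗ Λ.adjoint = LinearMap.id) (x : E) :
    ‖Λ x‖ ≤ ‖x‖ := by
  have hQ := isSymmetricProjection_adjoint_comp_self hΛ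
  refine le_of_sq_le_sq ?_ (norm_nonneg x)
  calc ‖Λ x‖ ^ 2 = ⟪(Λ.adjoint ∘ₗ Λ) x, x⟫ := by
        rw [LinearMap.comp_apply, LinearMap.adjoint_inner_left, real_inner_self_eq_norm_sq]
    _ = ‖(Λ.adjoint ∘ₗ Λ) x‖ ^ 2 := inner_map_self_of_isSymmetricProjection hQ x
    _ ≤ ‖x‖ ^ 2 :=
        pow_le_pow_left₀ (norm_nonneg _) (norm_map_le_of_isSymmetricProjection hQ x) 2

end Projections

section SchurComplement

variable {E : Type*} [NormedAddCommGroup E] [InnerProductSpace ℝ E] {T : E →ₗ[ℝ] E}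

theorem inner_blockOperator_left (T : E →ₗ[ℝ] E) (v : E) (φ : E →ₗ[ℝ] ℝ) (t : ℝ)
    (x z : WithLp 2 (E × ℝ)) :
    ⟪blockOperator T v φ t x, z⟫ =
      ⟪T x.fst, z.fst⟫ + x.snd * ⟪v, z.fst⟫ + (φ x.fst + t * x.snd) * z.snd := by
  rw [WithLp.prod_inner_apply, ← real_inner_smul_left, ← inner_add_left]
  exact congrArg _ (mul_comm _ _)

theorem isSymmetric_blockOperator (hT : T.IsSymmetric) (v : E) (t : ℝ) :
    (blockOperator T v (innerₗ E v) t).IsSymmetric := fun x z => by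
  rw [← real_inner_comm x, inner_blockOperator_left, inner_blockOperator_left, hT,
    real_inner_comm x.fst, innerₗ_apply_apply, innerₗ_apply_apply]
  ring

theorem inner_blockOperator_self (hT : T.IsSymmetric) (f : E) (t : ℝ) (x : WithLp 2 (E × ℝ)) :
    ⟪blockOperator T (T f) (innerₗ E (T f)) t x, x⟫ =
      ⟪T (x.fst + x.snd • f), x.fst + x.snd • f⟫ + (t - ⟪T f, f⟫) * x.snd ^ 2 := by
  have hxf : ⟪T x.fst, f⟫ = ⟪T f, x.fst⟫ := (hT x.fst f).trans (real_inner_comm _ _)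
  rw [inner_blockOperator_left, innerₗ_apply_apply]
  simp only [map_add, map_smul, inner_add_left, inner_add_right, real_inner_smul_left,
    real_inner_smul_right, hxf]
  ring

theorem isPositive_blockOperator_iff (hT : T.IsPositive) {f : E} {t : ℝ} :
    (blockOperator T (T f) (innerₗ E (T f)) t).IsPositive ↔ ⟪T f, f⟫ ≤ t := by
  constructor
  · intro h
    have hnonneg := h.re_inner_nonneg_left (WithLp.toLp 2 (-f, 1))
    rw [RCLike.re_to_real, inner_blockOperator_self hT.isSymmetric] at hnonneg
    simpa using hnonneg
  · refine fun h => ⟨isSymmetric_blockOperator hT.isSymmetric _ _, fun x => ?_⟩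
    rw [RCLike.re_to_real, inner_blockOperator_self hT.isSymmetric]
    exact add_nonneg (hT.re_inner_nonneg_left _) (mul_nonneg (sub_nonneg.2 h) (sq_nonneg _))

end SchurComplement

section WeakDuality

variable {H : Type*} [NormedAddCommGroup H] [InnerProductSpace ℝ H] [FiniteDimensional ℝ H] {m : ℕ}
  {P : H →ₗ[ℝ] H} {Λ : H →ₗ[ℝ] EuclideanSpace ℝ (Fin m)} {y : EuclideanSpace ℝ (Fin m)}
  {c d t ε η : ℝ} {f : H}

theorem isSymmetric_combination (hP : P.IsSymmetric) : (combination P Λ c d).IsSymmetric :=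
  (hP.smul (conj_trivial c)).add ((LinearMap.isSymmetric_adjoint_comp_self Λ).smul (conj_trivial d))

theorem inner_combination_self (hP : P.IsSymmetricProjection) (x : H) :
    ⟪combination P Λ c d x, x⟫ = c * ‖P x‖ ^ 2 + d * ‖Λ x‖ ^ 2 := by
  simp only [combination, LinearMap.add_apply, LinearMap.smul_apply, LinearMap.comp_apply,
    inner_add_left, real_inner_smul_left, LinearMap.adjoint_inner_left,
    inner_map_self_of_isSymmetricProjection hP, real_inner_self_eq_norm_sq]

theorem isPositive_combination_sub_id_iff (hP : P.IsSymmetricProjection) :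
    (combination P Λ c d - LinearMap.id).IsPositive ↔
      ∀ x, ‖x‖ ^ 2 ≤ c * ‖P x‖ ^ 2 + d * ‖Λ x‖ ^ 2 := by
  have hinner : ∀ x, ⟪(combination P Λ c d - LinearMap.id : H →ₗ[ℝ] H) x, x⟫ =
      c * ‖P x‖ ^ 2 + d * ‖Λ x‖ ^ 2 - ‖x‖ ^ 2 := fun x => by
    rw [LinearMap.sub_apply, inner_sub_left, inner_combination_self hP, LinearMap.id_apply,
      real_inner_self_eq_norm_sq]
  simp only [LinearMap.IsPositive, RCLike.re_to_real, hinner, sub_nonneg, and_iff_right_iff_imp]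
  exact fun _ => (isSymmetric_combination hP.isSymmetric).sub LinearMap.IsSymmetric.id

theorem mem_sdpFeasible_iff (hP : P.IsSymmetricProjection)
    (hf : combination P Λ c d f = d • Λ.adjoint y) :
    (c, d, t) ∈ sdpFeasible P Λ y ↔ 0 ≤ c ∧ 0 ≤ d ∧
      (∀ x, ‖x‖ ^ 2 ≤ c * ‖P x‖ ^ 2 + d * ‖Λ x‖ ^ 2) ∧ ⟪combination P Λ c d f, f⟫ ≤ t := by
  have hφ : d • (innerₗ (EuclideanSpace ℝ (Fin m)) y ∘ₗ Λ) = innerₗ H (d • Λ.adjoint y) :=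
    LinearMap.ext fun x => by
      simp only [LinearMap.smul_apply, LinearMap.comp_apply, innerₗ_apply_apply,
        real_inner_smul_left, LinearMap.adjoint_inner_left, smul_eq_mul]
  change (0 ≤ c ∧ 0 ≤ d ∧ _ ∧ _) ↔ _
  rw [isPositive_combination_sub_id_iff hP, hφ, ← hf]
  refine and_congr_right fun hc => and_congr_right fun hd => and_congr_right fun _ => ?_
  refine isPositive_blockOperator_iff ⟨isSymmetric_combination hP.isSymmetric, fun x => ?_⟩
  rw [RCLike.re_to_real, inner_combination_self hP]
  positivity

theorem exists_combination_eq (hP : P.IsSymmetricProjection)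
    (hbound : ∀ x, ‖x‖ ^ 2 ≤ c * ‖P x‖ ^ 2 + d * ‖Λ x‖ ^ 2) (z : H) :
    ∃ f, combination P Λ c d f = z := by
  refine LinearMap.injective_iff_surjective.1 ((injective_iff_map_eq_zero _).2 fun x hx => ?_) z
  have hle := hbound x
  rw [← inner_combination_self hP, hx, inner_zero_left] at hle
  simpa using hle.antisymm (sq_nonneg _)

theorem regularization_eq_add (hP : P.IsSymmetricProjection)
    (hf : combination P Λ c d f = d • Λ.adjoint y) (x : H) :
    c * ‖P x‖ ^ 2 + d * ‖y - Λ x‖ ^ 2 =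
      d * ‖y‖ ^ 2 - ⟪combination P Λ c d f, f⟫ + (c * ‖P (x - f)‖ ^ 2 + d * ‖Λ (x - f)‖ ^ 2) := by
  have hfx : ⟪combination P Λ c d f, x⟫ = d * ⟪y, Λ x⟫ := by
    rw [hf, real_inner_smul_left, LinearMap.adjoint_inner_left]
  have hxf : ⟪combination P Λ c d x, f⟫ = ⟪combination P Λ c d f, x⟫ :=
    (isSymmetric_combination hP.isSymmetric x f).trans (real_inner_comm _ _)
  rw [← inner_combination_self hP, map_sub, inner_sub_left, inner_sub_right, inner_sub_right,
    inner_combination_self hP x, norm_sub_sq_real, hxf, hfx]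
  ring

theorem regularizers_eq_singleton (hP : P.IsSymmetricProjection)
    (hbound : ∀ x, ‖x‖ ^ 2 ≤ c * ‖P x‖ ^ 2 + d * ‖Λ x‖ ^ 2)
    (hf : combination P Λ c d f = d • Λ.adjoint y) : regularizers P Λ y c d = {f} := by
  have hmin : ∀ g x : H, c * ‖P g‖ ^ 2 + d * ‖y - Λ g‖ ^ 2 ≤ c * ‖P x‖ ^ 2 + d * ‖y - Λ x‖ ^ 2 ↔
      c * ‖P (g - f)‖ ^ 2 + d * ‖Λ (g - f)‖ ^ 2 ≤ c * ‖P (x - f)‖ ^ 2 + d * ‖Λ (x - f)‖ ^ 2 :=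
    fun g x => by
      rw [regularization_eq_add hP hf, regularization_eq_add hP hf x, add_le_add_iff_left]
  ext g
  simp only [regularizers, Set.mem_ofPred_eq, Set.mem_singleton_iff, isMinOn_iff, Set.mem_univ,
    forall_true_left, hmin]
  constructor
  · intro h
    have hle := (hbound (g - f)).trans (h f)
    rw [sub_self, map_zero, map_zero, norm_zero, norm_zero] at hle
    exact sub_eq_zero.1 (by simpa using hle)
  · rintro rfl x
    rw [sub_self, map_zero, map_zero, norm_zero, norm_zero]
    simpa using (sq_nonneg _).trans (hbound (x - g))

theorem exists_norm_sub_sq_le_sdpObjective (hP : P.IsSymmetricProjection)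
    (hfeas : (c, d, t) ∈ sdpFeasible P Λ y) :
    ∃ f, regularizers P Λ y c d = {f} ∧
      ∀ x ∈ consistentSet Λ (modelSet P ε) (uncertaintySet m η) y,
        ‖x - f‖ ^ 2 ≤ sdpObjective ε η y (c, d, t) := by
  obtain ⟨f, hf⟩ := exists_combination_eq hP ((isPositive_combination_sub_id_iff hP).1 hfeas.2.2.1)
    (d • Λ.adjoint y)
  obtain ⟨hc, hd, hbound, ht⟩ := (mem_sdpFeasible_iff hP hf).1 hfeas
  refine ⟨f, regularizers_eq_singleton hP hbound hf, fun x ⟨hPx, hΛx⟩ => ?_⟩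
  have hcP := mul_le_mul_of_nonneg_left (pow_le_pow_left₀ (norm_nonneg _) hPx 2) hc
  have hdΛ := mul_le_mul_of_nonneg_left (pow_le_pow_left₀ (norm_nonneg _) hΛx 2) hd
  calc ‖x - f‖ ^ 2 ≤ c * ‖P (x - f)‖ ^ 2 + d * ‖Λ (x - f)‖ ^ 2 := hbound (x - f)
    _ = c * ‖P x‖ ^ 2 + d * ‖y - Λ x‖ ^ 2 - d * ‖y‖ ^ 2 + ⟪combination P Λ c d f, f⟫ := by
        rw [regularization_eq_add hP hf x]
        ring
    _ ≤ c * ε ^ 2 + d * η ^ 2 - d * ‖y‖ ^ 2 + t := by gcongr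

end WeakDuality

section ChebyshevCenter

theorem subset_closedBall_iff_norm_sub_sq_le {E : Type*} [SeminormedAddCommGroup E] {S : Set E}
    {z : E} {r : ℝ} (hr : 0 ≤ r) :
    S ⊆ Metric.closedBall z r ↔ ∀ x ∈ S, ‖x - z‖ ^ 2 ≤ r ^ 2 :=
  forall₂_congr fun _ _ => mem_closedBall_iff_norm.trans (sq_le_sq₀ (norm_nonneg _) hr).symm

variable {H : Type*} [NormedAddCommGroup H] [InnerProductSpace ℝ H] {S : Set H} {f v z : H}

theorem norm_sub_sq_add_norm_sq_le (hadd : f + v ∈ S) (hsub : f - v ∈ S) {ρ : ℝ}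
    (hS : ∀ x ∈ S, ‖x - z‖ ^ 2 ≤ ρ) : ‖f - z‖ ^ 2 + ‖v‖ ^ 2 ≤ ρ := by
  have hadd' : ‖f - z + v‖ ^ 2 ≤ ρ := by
    rw [sub_add_eq_add_sub]
    exact hS _ hadd
  have hsub' : ‖f - z - v‖ ^ 2 ≤ ρ := by
    rw [sub_right_comm]
    exact hS _ hsub
  linarith [parallelogram_law_with_norm ℝ (f - z) v]

theorem isChebyshevRadius_norm (hadd : f + v ∈ S) (hsub : f - v ∈ S)
    (hS : S ⊆ Metric.closedBall z ‖v‖) : IsChebyshevRadius S ‖v‖ := by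
  refine IsLeast.isGLB ⟨⟨norm_nonneg v, z, hS⟩, ?_⟩
  rintro r ⟨hr, w, hw⟩
  have hle := norm_sub_sq_add_norm_sq_le hadd hsub ((subset_closedBall_iff_norm_sub_sq_le hr).1 hw)
  exact le_of_sq_le_sq ((le_add_of_nonneg_left (sq_nonneg _)).trans hle) hr

theorem eq_of_subset_closedBall_norm (hadd : f + v ∈ S) (hsub : f - v ∈ S)
    (hS : S ⊆ Metric.closedBall z ‖v‖) : z = f := by
  have hle := norm_sub_sq_add_norm_sq_le hadd hsub
    ((subset_closedBall_iff_norm_sub_sq_le (norm_nonneg v)).1 hS)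
  exact (sub_eq_zero.1 (by simpa using hle)).symm

theorem setOf_isChebyshevCenter_eq_singleton (hadd : f + v ∈ S) (hsub : f - v ∈ S)
    (hS : S ⊆ Metric.closedBall z ‖v‖) : {w | IsChebyshevCenter S w} = {z} := by
  have hrad := isChebyshevRadius_norm hadd hsub hS
  refine Set.eq_singleton_iff_unique_mem.2 ⟨⟨_, hrad, hS⟩, ?_⟩
  rintro w ⟨r, hr, hw⟩
  obtain rfl := hr.unique hrad
  rw [eq_of_subset_closedBall_norm hadd hsub hw, eq_of_subset_closedBall_norm hadd hsub hS]

end ChebyshevCenter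

section StrongDuality

theorem convexCombination_sub_nonneg {ε η ρ s : ℝ} (hρ : ρ ≤ (ε + η) ^ 2)
    (hs : s ∈ Set.Icc (0 : ℝ) 1) : 0 ≤ (1 - s) * ε ^ 2 + s * η ^ 2 - s * (1 - s) * ρ :=
  calc 0 ≤ ((1 - s) * ε - s * η) ^ 2 + s * (1 - s) * ((ε + η) ^ 2 - ρ) :=
        add_nonneg (sq_nonneg _)
          (mul_nonneg (mul_nonneg hs.1 (sub_nonneg.2 hs.2)) (sub_nonneg.2 hρ))
    _ = (1 - s) * ε ^ 2 + s * η ^ 2 - s * (1 - s) * ρ := by ring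

theorem hasDerivAt_convexCombination_sub (ε η ρ s : ℝ) :
    HasDerivAt (fun s => (1 - s) * ε ^ 2 + s * η ^ 2 - s * (1 - s) * ρ)
      (η ^ 2 - ε ^ 2 - ρ + 2 * s * ρ) s := by
  have hid := hasDerivAt_id' s
  have h := (((hid.const_sub 1).mul_const (ε ^ 2)).add (hid.mul_const (η ^ 2))).sub
    ((hid.mul (hid.const_sub 1)).mul_const ρ)
  exact h.congr_deriv (by ring)

theorem exists_multipliers_and_norm_sq_eq {V F₁ F₂ : Type*} [NormedAddCommGroup V]
    [InnerProductSpace ℝ V] [FiniteDimensional ℝ V] [Nontrivial V] [NormedAddCommGroup F₁]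
    [InnerProductSpace ℝ F₁] [NormedAddCommGroup F₂] [InnerProductSpace ℝ F₂]
    {T₁ : V →ₗ[ℝ] F₁} {T₂ : V →ₗ[ℝ] F₂}
    (h₁ : ∀ x, ‖T₁ x‖ ≤ ‖x‖) (h₂ : ∀ x, ‖T₂ x‖ ≤ ‖x‖) (hker : ∀ x, T₁ x = 0 → T₂ x = 0 → x = 0)
    {ε η ρ : ℝ} (hε : 0 < ε) (hη : 0 < η) (hρ : ρ ≤ (ε + η) ^ 2) :
    ∃ c d τ : ℝ, 0 ≤ c ∧ 0 ≤ d ∧ 1 ≤ c + d ∧ (c + d) * τ = d ∧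
      (∀ x, ‖x‖ ^ 2 ≤ c * ‖T₁ x‖ ^ 2 + d * ‖T₂ x‖ ^ 2) ∧
      ∃ v, ‖v‖ ^ 2 = c * (ε ^ 2 - τ ^ 2 * ρ) + d * (η ^ 2 - (1 - τ) ^ 2 * ρ) ∧
        ‖T₁ v‖ ^ 2 ≤ ε ^ 2 - τ ^ 2 * ρ ∧ ‖T₂ v‖ ^ 2 ≤ η ^ 2 - (1 - τ) ^ 2 * ρ := by
  obtain ⟨τ, hτ, l, hl, hmin, v, hv, hv₁, hv₂⟩ := exists_norm_sq_le_pencil_and_le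
    (A := normSqForm T₁) (B := normSqForm T₂)
    (fun x => (normSqForm_apply T₁ x).symm ▸ sq_nonneg _)
    (fun x => (normSqForm_apply T₂ x).symm ▸ sq_nonneg _)
    (fun x hx₁ hx₂ => hker x (by simpa [normSqForm_apply] using hx₁)
      (by simpa [normSqForm_apply] using hx₂))
    (fun s _ => hasDerivAt_convexCombination_sub ε η ρ s)
    (fun s hs => convexCombination_sub_nonneg hρ hs)
    (by simpa using pow_pos hε 2) (by simpa using pow_pos hη 2)
  simp only [pencil_apply, normSqForm_apply] at hmin hv₁ hv₂
  have hl1 : l ≤ 1 := by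
    obtain ⟨x, hx⟩ := exists_norm_eq V zero_le_one
    have h₁x := pow_le_pow_left₀ (norm_nonneg _) (h₁ x) 2
    have h₂x := pow_le_pow_left₀ (norm_nonneg _) (h₂ x) 2
    have hlx := hmin x
    rw [hx] at h₁x h₂x hlx
    nlinarith [hτ.1, hτ.2]
  refine ⟨(1 - τ) / l, τ / l, τ, div_nonneg (sub_nonneg.2 hτ.2) hl.le, div_nonneg hτ.1 hl.le,
    ?_, ?_, fun x => ?_, v, ?_, by linarith, by linarith⟩
  · rw [← add_div, sub_add_cancel]
    exact (one_le_div hl).2 hl1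
  · rw [← add_div, sub_add_cancel, one_div_mul_eq_div]
  · rw [div_mul_eq_mul_div, div_mul_eq_mul_div, ← add_div, le_div_iff₀ hl, mul_comm]
    exact hmin x
  · rw [div_mul_eq_mul_div, div_mul_eq_mul_div, ← add_div, eq_div_iff hl.ne', mul_comm, hv]
    ring

/-- `y = Λ u + Λ q`, where `u` is annihilated by `P` and `q` lies in the common range of the
projections `P` and `Λ* Λ`. The part `q` is the one on which the two constraints compete. -/
structure IsDataSplitting {E F : Type*} [NormedAddCommGroup E] [InnerProductSpace ℝ E]
    [FiniteDimensional ℝ E] [NormedAddCommGroup F] [InnerProductSpace ℝ F] [FiniteDimensional ℝ F]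
    (P : E →ₗ[ℝ] E) (Λ : E →ₗ[ℝ] F) (y : F) (u q : E) : Prop where
  map_left : P u = 0
  map_right : P q = q
  adjoint_map_right : Λ.adjoint (Λ q) = q
  map_add_map : Λ u + Λ q = y

variable {E F : Type*} [NormedAddCommGroup E] [InnerProductSpace ℝ E]
  [FiniteDimensional ℝ E] [NormedAddCommGroup F] [InnerProductSpace ℝ F] [FiniteDimensional ℝ F]
  {P : E →ₗ[ℝ] E} {Λ : E →ₗ[ℝ] F} {y : F} {u q : E}

-- `q` is the component of `Λ* y` orthogonal to `Λ* Λ (ker P)`.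
theorem exists_isDataSplitting (hP : P.IsSymmetricProjection)
    (hΛ : Λ ∘ₗ Λ.adjoint = LinearMap.id) (y : F) : ∃ u q, IsDataSplitting P Λ y u q := by
  have hΛΛ : ∀ e, Λ (Λ.adjoint e) = e := LinearMap.congr_fun hΛ
  obtain ⟨_, ⟨u, hu, rfl⟩, q, hq, hy⟩ :=
    ((LinearMap.ker P).map (Λ.adjoint ∘ₗ Λ)).exists_add_mem_mem_orthogonal (Λ.adjoint y)
  have hΛq : Λ u + Λ q = y := by
    simpa only [hΛΛ, map_add, LinearMap.comp_apply] using (congrArg Λ hy).symm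
  have hQq : Λ.adjoint (Λ q) = q := by
    rw [eq_sub_of_add_eq' hΛq, map_sub, hy, LinearMap.comp_apply, add_sub_cancel_left]
  have hker : ∀ x ∈ LinearMap.ker P, ⟪x, q⟫ = 0 := fun x hx => by
    have hsymm := LinearMap.isSymmetric_adjoint_comp_self Λ x q
    rw [LinearMap.comp_apply _ _ q, hQq] at hsymm
    exact hsymm.symm.trans (hq _ (Submodule.mem_map_of_mem hx))
  refine ⟨u, q, hu, ?_, hQq, hΛq⟩
  have hPx : P (q - P q) = 0 := by
    rw [map_sub, sub_eq_zero]
    exact (LinearMap.congr_fun hP.isIdempotentElem.eq q).symm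
  have hself : ⟪q - P q, q - P q⟫ = 0 := by
    rw [inner_sub_right, hker _ hPx, ← hP.isSymmetric, hPx, inner_zero_left, sub_zero]
  exact (sub_eq_zero.1 (inner_self_eq_zero.1 hself)).symm

namespace IsDataSplitting

theorem inner_projection_right (h : IsDataSplitting P Λ y u q) (hP : P.IsSymmetric) (x : E) :
    ⟪P q, P x⟫ = ⟪q, x⟫ := by
  rw [h.map_right, ← hP, h.map_right]

theorem inner_measurement_right (h : IsDataSplitting P Λ y u q) (x : E) : ⟪Λ q, Λ x⟫ = ⟪q, x⟫ := by
  rw [← LinearMap.adjoint_inner_left, h.adjoint_map_right]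

theorem norm_right_le (h : IsDataSplitting P Λ y u q) (hP : P.IsSymmetric) {ε η : ℝ} {x : E}
    (hx : ‖P x‖ ≤ ε) (hyx : ‖y - Λ x‖ ≤ η) : ‖q‖ ≤ ε + η := by
  have hΛq : ‖Λ q‖ = ‖q‖ := by
    rw [norm_eq_sqrt_real_inner, h.inner_measurement_right, norm_eq_sqrt_real_inner]
  have hqu : ⟪q, u⟫ = 0 := by rw [← h.map_right, hP, h.map_left, inner_zero_right]
  rcases (norm_nonneg q).eq_or_lt with hq | hq
  · exact hq ▸ add_nonneg ((norm_nonneg _).trans hx) ((norm_nonneg _).trans hyx)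
  refine le_of_mul_le_mul_left ?_ hq
  calc ‖q‖ * ‖q‖ = ⟪P q, P x⟫ + ⟪Λ q, y - Λ x⟫ := by
        rw [h.inner_projection_right hP, ← h.map_add_map, inner_sub_right, inner_add_right,
          h.inner_measurement_right, h.inner_measurement_right, h.inner_measurement_right, hqu,
          real_inner_self_eq_norm_mul_norm]
        ring
    _ ≤ ‖P q‖ * ‖P x‖ + ‖Λ q‖ * ‖y - Λ x‖ :=
        add_le_add (real_inner_le_norm _ _) (real_inner_le_norm _ _)
    _ ≤ ‖q‖ * (ε + η) := by
        rw [h.map_right, hΛq, mul_add]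
        gcongr

theorem map_add_smul (h : IsDataSplitting P Λ y u q) (τ : ℝ) : P (u + τ • q) = τ • q := by
  rw [map_add, map_smul, h.map_left, h.map_right, zero_add]

theorem sub_map_add_smul (h : IsDataSplitting P Λ y u q) (τ : ℝ) :
    y - Λ (u + τ • q) = (1 - τ) • Λ q := by
  rw [← h.map_add_map, map_add, map_smul, add_sub_add_left_eq_sub, sub_smul, one_smul]

theorem norm_sq_le_of_forall_orthogonal (h : IsDataSplitting P Λ y u q) (hP : P.IsSymmetric)
    {c d : ℝ} (hcd : 1 ≤ c + d)
    (hbound : ∀ w : (ℝ ∙ q)ᗮ, ‖w‖ ^ 2 ≤ c * ‖P w‖ ^ 2 + d * ‖Λ w‖ ^ 2) (x : E) :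
    ‖x‖ ^ 2 ≤ c * ‖P x‖ ^ 2 + d * ‖Λ x‖ ^ 2 := by
  obtain ⟨_, hz, w, hw, rfl⟩ := (ℝ ∙ q).exists_add_mem_mem_orthogonal x
  obtain ⟨a, rfl⟩ := Submodule.mem_span_singleton.1 hz
  have hqw := Submodule.mem_orthogonal_singleton_iff_inner_right.1 hw
  calc ‖a • q + w‖ ^ 2 = a ^ 2 * ‖q‖ ^ 2 + ‖w‖ ^ 2 :=
        norm_map_smul_add_sq LinearMap.id (fun _ => rfl) hqw a
    _ ≤ (c + d) * (a ^ 2 * ‖q‖ ^ 2) + (c * ‖P w‖ ^ 2 + d * ‖Λ w‖ ^ 2) :=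
        add_le_add (le_mul_of_one_le_left (by positivity) hcd) (hbound ⟨w, hw⟩)
    _ = c * ‖P (a • q + w)‖ ^ 2 + d * ‖Λ (a • q + w)‖ ^ 2 := by
        rw [norm_map_smul_add_sq P (h.inner_projection_right hP) hqw,
          norm_map_smul_add_sq Λ h.inner_measurement_right hqw]
        ring

theorem orthogonal_span_ne_bot [Nontrivial E] (h : IsDataSplitting P Λ y u q)
    (hΛ : Λ ∘ₗ Λ.adjoint = LinearMap.id)
    (hline : ¬ (Module.finrank ℝ E = 1 ∧ P = LinearMap.id ∧ Module.finrank ℝ F = 1)) :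
    (ℝ ∙ q)ᗮ ≠ ⊥ := by
  intro hbot
  have htop : (ℝ ∙ q) = ⊤ := (Submodule.orthogonal_eq_bot_iff).1 hbot
  have hspan : ∀ x : E, ∃ a : ℝ, a • q = x := fun x =>
    Submodule.mem_span_singleton.1 (htop ▸ Submodule.mem_top)
  have hq : q ≠ 0 := by
    rintro rfl
    rw [Submodule.span_zero_singleton] at htop
    exact bot_ne_top htop
  have hrank : Module.finrank ℝ E = 1 := by rw [← finrank_top, ← htop, finrank_span_singleton hq]
  have hPid : P = LinearMap.id := LinearMap.ext fun x => by
    obtain ⟨a, rfl⟩ := hspan x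
    rw [map_smul, h.map_right, LinearMap.id_apply]
  have hQid : Λ.adjoint ∘ₗ Λ = LinearMap.id := LinearMap.ext fun x => by
    obtain ⟨a, rfl⟩ := hspan x
    rw [map_smul, LinearMap.comp_apply, h.adjoint_map_right, LinearMap.id_apply]
  have hrank' := (LinearEquiv.ofLinearMap Λ Λ.adjoint hΛ hQid).finrank_eq.symm.trans hrank
  exact hline ⟨hrank, hPid, hrank'⟩

variable {m : ℕ} {Λ : E →ₗ[ℝ] EuclideanSpace ℝ (Fin m)} {y : EuclideanSpace ℝ (Fin m)}

theorem combination_add_smul (h : IsDataSplitting P Λ y u q) {c d τ : ℝ} (hτ : (c + d) * τ = d) :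
    combination P Λ c d (u + τ • q) = d • Λ.adjoint y := by
  have hQ : Λ.adjoint (Λ (u + τ • q)) = Λ.adjoint y - (1 - τ) • q := by
    rw [← sub_sub_cancel y (Λ (u + τ • q)), h.sub_map_add_smul, map_sub, map_smul,
      h.adjoint_map_right]
  rw [combination, LinearMap.add_apply, LinearMap.smul_apply, LinearMap.smul_apply,
    LinearMap.comp_apply, h.map_add_smul, hQ, smul_sub, smul_smul, smul_smul, add_sub_left_comm,
    ← sub_smul, show c * τ - d * (1 - τ) = 0 by linear_combination hτ, zero_smul, add_zero]

theorem sdpObjective_eq (h : IsDataSplitting P Λ y u q) (hP : P.IsSymmetricProjection)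
    {c d τ : ℝ} (hτ : (c + d) * τ = d) (ε η : ℝ) :
    sdpObjective ε η y (c, d, ⟪combination P Λ c d (u + τ • q), u + τ • q⟫) =
      c * (ε ^ 2 - τ ^ 2 * ‖q‖ ^ 2) + d * (η ^ 2 - (1 - τ) ^ 2 * ‖q‖ ^ 2) := by
  have hΛq : ‖Λ q‖ ^ 2 = ‖q‖ ^ 2 := by
    rw [← real_inner_self_eq_norm_sq, h.inner_measurement_right, real_inner_self_eq_norm_sq]
  have hexp := regularization_eq_add hP (h.combination_add_smul hτ) (u + τ • q)
  rw [h.map_add_smul, h.sub_map_add_smul, sub_self, map_zero, map_zero, norm_zero, norm_zero,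
    norm_smul, norm_smul, mul_pow, mul_pow, Real.norm_eq_abs, Real.norm_eq_abs, sq_abs, sq_abs,
    hΛq] at hexp
  rw [sdpObjective]
  linear_combination hexp

theorem add_smul_add_mem_consistentSet (h : IsDataSplitting P Λ y u q) (hP : P.IsSymmetric)
    {ε η τ : ℝ} (hε : 0 ≤ ε) (hη : 0 ≤ η) {w : E} (hqw : ⟪q, w⟫ = 0)
    (hPw : ‖P w‖ ^ 2 ≤ ε ^ 2 - τ ^ 2 * ‖q‖ ^ 2)
    (hΛw : ‖Λ w‖ ^ 2 ≤ η ^ 2 - (1 - τ) ^ 2 * ‖q‖ ^ 2) :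
    u + τ • q + w ∈ consistentSet Λ (modelSet P ε) (uncertaintySet m η) y := by
  have hPx : P (u + τ • q + w) = P (τ • q + w) := by rw [add_assoc, map_add, h.map_left, zero_add]
  have hyx : y - Λ (u + τ • q + w) = Λ ((1 - τ) • q + -w) := by
    rw [map_add, ← sub_sub, h.sub_map_add_smul, map_add, map_smul, map_neg, sub_eq_add_neg]
  refine ⟨le_of_sq_le_sq ?_ hε, le_of_sq_le_sq ?_ hη⟩
  · rw [hPx, norm_map_smul_add_sq P (h.inner_projection_right hP) hqw]
    linarith
  · have hqw' : ⟪q, -w⟫ = 0 := by rw [inner_neg_right, hqw, neg_zero]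
    rw [hyx, norm_map_smul_add_sq Λ h.inner_measurement_right hqw', map_neg, norm_neg]
    linarith

end IsDataSplitting

variable {m : ℕ} {Λ : E →ₗ[ℝ] EuclideanSpace ℝ (Fin m)} {y : EuclideanSpace ℝ (Fin m)} {ε η : ℝ}

theorem exists_mem_sdpFeasible_norm_sq_eq (hP : P.IsSymmetricProjection)
    (hΛ : Λ ∘ₗ Λ.adjoint = LinearMap.id) (hker : LinearMap.ker P ⊓ LinearMap.ker Λ = ⊥)
    (hline : ¬ (Module.finrank ℝ E = 1 ∧ P = LinearMap.id ∧ m = 1)) (hε : 0 < ε) (hη : 0 < η)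
    (hne : (consistentSet Λ (modelSet P ε) (uncertaintySet m η) y).Nonempty) :
    ∃ p ∈ sdpFeasible P Λ y, ∃ f v : E, ‖v‖ ^ 2 = sdpObjective ε η y p ∧
      f + v ∈ consistentSet Λ (modelSet P ε) (uncertaintySet m η) y ∧
      f - v ∈ consistentSet Λ (modelSet P ε) (uncertaintySet m η) y := by
  obtain ⟨x, hx⟩ := hne
  rcases subsingleton_or_nontrivial E with hE | hE
  · have hmem := (mem_sdpFeasible_iff (Λ := Λ) (y := y) (c := 0) (d := 0) (t := 0) (f := 0) hP
      (Subsingleton.elim _ _)).2 ⟨le_rfl, le_rfl, by simp [Subsingleton.elim _ (0 : E)], by simp⟩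
    refine ⟨_, hmem, x, 0, by simp [sdpObjective], by rwa [add_zero], by rwa [sub_zero]⟩
  obtain ⟨u, q, h⟩ := exists_isDataSplitting hP hΛ y
  have : Nontrivial (ℝ ∙ q)ᗮ := Submodule.nontrivial_iff_ne_bot.2
    (h.orthogonal_span_ne_bot hΛ (by rwa [finrank_euclideanSpace_fin]))
  have hq : ‖q‖ ^ 2 ≤ (ε + η) ^ 2 :=
    pow_le_pow_left₀ (norm_nonneg q) (h.norm_right_le hP.isSymmetric hx.1 hx.2) 2
  obtain ⟨c, d, τ, hc, hd, hcd, hτ, hbound, v, hv, hPv, hΛv⟩ := exists_multipliers_and_norm_sq_eq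
    (T₁ := P ∘ₗ (ℝ ∙ q)ᗮ.subtype) (T₂ := Λ ∘ₗ (ℝ ∙ q)ᗮ.subtype)
    (fun w => norm_map_le_of_isSymmetricProjection hP w)
    (fun w => norm_map_le_of_comp_adjoint_eq_id hΛ w)
    (fun w hPw hΛw => Subtype.ext <| (Submodule.mem_bot ℝ).1 (hker ▸ ⟨hPw, hΛw⟩)) hε hη hq
  have hqv : ⟪q, (v : E)⟫ = 0 := Submodule.mem_orthogonal_singleton_iff_inner_right.1 v.2
  refine ⟨(c, d, ⟪combination P Λ c d (u + τ • q), u + τ • q⟫),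
    (mem_sdpFeasible_iff hP (h.combination_add_smul hτ)).2
      ⟨hc, hd, h.norm_sq_le_of_forall_orthogonal hP.isSymmetric hcd hbound, le_rfl⟩,
    u + τ • q, v, hv.trans (h.sdpObjective_eq hP hτ ε η).symm,
    h.add_smul_add_mem_consistentSet hP.isSymmetric hε.le hη.le hqv hPv hΛv, ?_⟩
  rw [sub_eq_add_neg]
  exact h.add_smul_add_mem_consistentSet hP.isSymmetric hε.le hη.le
    (by rw [inner_neg_right, hqv, neg_zero]) (by rwa [map_neg, norm_neg])
    (by rwa [map_neg, norm_neg])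

end StrongDuality

end ChebyshevSDP

theorem theorem1 {H : Type*} [NormedAddCommGroup H] [InnerProductSpace ℝ H]
    [FiniteDimensional ℝ H] {m : ℕ}
    (P : H →ₗ[ℝ] H) (hP : P.IsSymmetricProjection)
    (Λ : H →ₗ[ℝ] EuclideanSpace ℝ (Fin m)) (hΛ : Λ ∘ₗ Λ.adjoint = LinearMap.id)
    (hker : LinearMap.ker P ⊓ LinearMap.ker Λ = ⊥)
    (hline : ¬ (Module.finrank ℝ H = 1 ∧ P = LinearMap.id ∧ m = 1))
    (ε η : ℝ) (hε : 0 < ε) (hη : 0 < η) (y : EuclideanSpace ℝ (Fin m))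
    (hne : (consistentSet Λ (modelSet P ε) (uncertaintySet m η) y).Nonempty) :
    (∃ r : ℝ, IsChebyshevRadius (consistentSet Λ (modelSet P ε) (uncertaintySet m η) y) r ∧
      IsLeast (sdpObjective ε η y '' sdpFeasible P Λ y) (r ^ 2)) ∧
    ∀ c d t : ℝ, IsSDPSolution P Λ ε η y (c, d, t) →
      ∃ f : H, regularizers P Λ y c d = {f} ∧
        {z : H | IsChebyshevCenter
          (consistentSet Λ (modelSet P ε) (uncertaintySet m η) y) z} = {f} := by
  obtain ⟨p, hp, f, v, hv, hadd, hsub⟩ :=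
    exists_mem_sdpFeasible_norm_sq_eq hP hΛ hker hline hε hη hne
  have hlow : ∀ p ∈ sdpFeasible P Λ y, ‖v‖ ^ 2 ≤ sdpObjective ε η y p := by
    rintro ⟨c, d, t⟩ hfeas
    obtain ⟨z, -, hz⟩ := exists_norm_sub_sq_le_sdpObjective hP hfeas
    linarith [norm_sub_sq_add_norm_sq_le hadd hsub hz, sq_nonneg ‖f - z‖]
  have hball : ∀ c d t, IsSDPSolution P Λ ε η y (c, d, t) → ∃ z, regularizers P Λ y c d = {z} ∧
      consistentSet Λ (modelSet P ε) (uncertaintySet m η) y ⊆ Metric.closedBall z ‖v‖ := by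
    intro c d t hsol
    obtain ⟨z, hreg, hz⟩ := exists_norm_sub_sq_le_sdpObjective hP hsol.1
    have hle : sdpObjective ε η y (c, d, t) ≤ ‖v‖ ^ 2 := (hsol.2 hp).trans_eq hv.symm
    exact ⟨z, hreg, (subset_closedBall_iff_norm_sub_sq_le (norm_nonneg v)).2 fun x hx =>
      (hz x hx).trans hle⟩
  refine ⟨⟨‖v‖, ?_, ⟨p, hp, hv.symm⟩, Set.forall_mem_image.2 hlow⟩, fun c d t hsol => ?_⟩
  · obtain ⟨z, -, hz⟩ := hball p.1 p.2.1 p.2.2 ⟨hp, fun p' hp' => hv.symm.trans_le (hlow p' hp')⟩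
    exact isChebyshevRadius_norm hadd hsub hz
  · obtain ⟨z, hreg, hz⟩ := hball c d t hsol
    exact ⟨z, hreg, setOf_isChebyshevCenter_eq_singleton hadd hsub hz⟩
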